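/- Let $\mathbb T$ be the unit circle with normalized Lebesgue measure, let $H^2_+\subseteq L^2(\mathbb T)$ and $H^\infty\subseteq L^\infty(\mathbb T)$ be the Hardy spaces (functions whose Fourier coefficients of negative index vanish), let $H^2_-=(H^2_+)^\perp$, and let $P^\pm$ be the orthogonal projections of $L^2(\mathbb T)$ onto $H^2_\pm$. For $a,b\in L^\infty(\mathbb T)$ put $S_{a,b}f=a\,P^+f+b\,P^-f$ for $f\in L^2(\mathbb T)$, and $\ker^+_{a,b}=P^+\ker S_{a,b}$. Let $a,b\in L^\infty(\mathbb T)$ be such that $a$, $b$ and $a-b$ are nonzero a.e. on $\mathbb T$, and let $h_+\in H^\infty$. (i) $h_+\ker^+_{ah_+,b}\subseteq\ker^+_{a,b}$ and $h_+\ker^+_{a,b}\subseteq\ker^+_{a,bh_+}$. (ii) If $h_+$ is invertible in $H^\infty$, then $h_+\ker^+_{ah_+,b}=\ker^+_{a,b}=h_+^{-1}\ker^+_{a,bh_+}$. (iii) Suppose that $h_+$ has a non-constant inner factor, i.e. $h_+=\theta g$ with $g\in H^\infty$ and $\theta$ a non-constant inner function ($\theta\in H^\infty$, $|\theta|=1$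 a.e.). If $\ker^+_{a,b}\neq\{0\}$, then $h_+\ker^+_{ah_+,b}\subsetneq\ker^+_{a,b}$. If $\ker^+_{a,bh_+}\neq\{0\}$, then $h_+\ker^+_{a,b}\subsetneq\ker^+_{a,bh_+}$. -/

import Mathlib

open MeasureTheory AddCircle
open scoped ENNReal

noncomputable section

namespace PairedKernel

/-- Normalized Lebesgue measure on the unit circle. The circle is parametrized by
`t ∈ ℝ / ℤ`, the point `t` standing for `z = exp (2 π i t)`, so that `fourier n` is `z ^ n`. -/
abbrev circleMeasure : Measure UnitAddCircle := haarAddCircle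

/-- `L²(𝕋)`. -/
abbrev L2 : Type := Lp ℂ 2 circleMeasure

/-- `L^∞(𝕋)`. -/
abbrev LInf : Type := Lp ℂ ∞ circleMeasure

/-- Pointwise product of two functions of `L^∞`. -/
def mulInf (f g : LInf) : LInf := (ContinuousLinearMap.mul ℂ ℂ).holder ∞ f g

/-- The multiplication operator `M_a : L² → L²`, `f ↦ a f`, for `a ∈ L^∞`. -/
def mulOp (a : LInf) : L2 →L[ℂ] L2 :=
  (ContinuousLinearMap.mul ℂ ℂ).holderL circleMeasure ∞ 2 2 a

theorem coeFn_mulInf (f g : LInf) : mulInf f g =ᵐ[circleMeasure] fun t => f t * g t :=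
  (ContinuousLinearMap.mul ℂ ℂ).coeFn_holder f g

theorem coeFn_mulOp (a : LInf) (f : L2) : mulOp a f =ᵐ[circleMeasure] fun t => a t * f t :=
  (ContinuousLinearMap.mul ℂ ℂ).coeFn_holder a f

/-- The Hardy space `H²₊` as a subspace of `L²(𝕋)` (boundary values): the functions whose Fourier
coefficients of negative index all vanish. -/
def HardyPlus : Submodule ℂ L2 where
  carrier := {f | ∀ n : ℤ, n < 0 → fourierCoeff f n = 0}
  zero_mem' n _ := by
    simp only [← fourierBasis_repr]
    simp
  add_mem' {f g} hf hg n hn := by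
    have h1 := hf n hn
    have h2 := hg n hn
    rw [← fourierBasis_repr] at h1 h2 ⊢
    simp [h1, h2]
  smul_mem' c f hf n hn := by
    have h1 := hf n hn
    rw [← fourierBasis_repr] at h1 ⊢
    simp [h1]

theorem isClosed_hardyPlus : IsClosed (HardyPlus : Set L2) := by
  have h : (HardyPlus : Set L2) =
      ⋂ n : ℤ, ⋂ _ : n < 0, {f : L2 | inner ℂ (fourierBasis (T := 1) n) f = 0} := by
    ext f
    simp only [Set.mem_iInter, Set.mem_ofPred_eq]
    refine forall₂_congr fun n _ => ?_
    rw [← fourierBasis_repr, HilbertBasis.repr_apply_apply]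
  rw [h]
  exact isClosed_iInter fun n => isClosed_iInter fun _ =>
    isClosed_eq (continuous_const.inner continuous_id) continuous_const

instance instCompleteHardyPlus : CompleteSpace HardyPlus :=
  isClosed_hardyPlus.completeSpace_coe

/-- `H²₋ = (H²₊)^⊥`. -/
def HardyMinus : Submodule ℂ L2 := HardyPlusᗮ

instance instCompleteHardyMinus : CompleteSpace HardyMinus :=
  (Submodule.isClosed_orthogonal HardyPlus).completeSpace_coe

/-- The orthogonal projection `P⁺` of `L²` onto `H²₊`, with values in `L²`. -/
def projPlus : L2 →L[ℂ] L2 := HardyPlus.starProjection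

/-- The orthogonal projection `P⁻` of `L²` onto `H²₋`, with values in `L²`. -/
def projMinus : L2 →L[ℂ] L2 := HardyMinus.starProjection

/-- The algebra `H^∞` (boundary values), as a subset of `L^∞(𝕋)`: the bounded functions whose
Fourier coefficients of negative index all vanish. -/
def HInf : Set LInf := {f | ∀ n : ℤ, n < 0 → fourierCoeff f n = 0}

/-- The paired operator `S_{a,b} f = a P⁺ f + b P⁻ f` on `L²`. -/
def pairedOp (a b : LInf) : L2 →L[ℂ] L2 := mulOp a ∘L projPlus + mulOp b ∘L projMinus

/-- The paired kernel `ker_{a,b} = ker S_{a,b}`. -/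
def pairedKer (a b : LInf) : Submodule ℂ L2 := (pairedOp a b).ker

/-- The projected paired kernel `ker⁺_{a,b} = P⁺ ker_{a,b}`. -/
def kerPlus (a b : LInf) : Submodule ℂ L2 := (pairedKer a b).map (projPlus : L2 →ₗ[ℂ] L2)

/-- The space `h M = {h φ : φ ∈ M}`. -/
def mulSpace (h : LInf) (M : Submodule ℂ L2) : Submodule ℂ L2 := M.map (mulOp h : L2 →ₗ[ℂ] L2)

/-- The pair `(a, b)` is nondegenerate: `a`, `b` and `a - b` are nonzero a.e. -/
def Nondegenerate (a b : LInf) : Prop :=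
  (∀ᵐ t ∂circleMeasure, a t ≠ 0) ∧ (∀ᵐ t ∂circleMeasure, b t ≠ 0) ∧
    ∀ᵐ t ∂circleMeasure, a t - b t ≠ 0

/-- `k` is the inverse of `h` in the algebra `H^∞`. -/
def IsInverseInHInf (h k : LInf) : Prop :=
  h ∈ HInf ∧ k ∈ HInf ∧ ∀ᵐ t ∂circleMeasure, h t * k t = 1

/-- Inner functions: `θ ∈ H^∞` with `|θ| = 1` a.e. on `𝕋`. -/
def IsInner (θ : LInf) : Prop := θ ∈ HInf ∧ ∀ᵐ t ∂circleMeasure, ‖θ t‖ = 1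

/-- `θ` is (a.e. equal to) a constant. -/
def IsConstant (θ : LInf) : Prop := ∃ c : ℂ, ∀ᵐ t ∂circleMeasure, θ t = c

/-- `h` has a non-constant inner factor: `h = θ g` with `θ` inner and non-constant, `g ∈ H^∞`. -/
def HasNonconstantInnerFactor (h : LInf) : Prop :=
  ∃ θ g : LInf, IsInner θ ∧ ¬ IsConstant θ ∧ g ∈ HInf ∧ h = mulInf θ g

end PairedKernel

end

/-!
Membership `f ∈ ker⁺_{a,b}` means that `f ∈ H²₊` and `a f + b g = 0` for some `g ∈ H²₋`
(`mem_kerPlus_iff`). Since multiplication by an element of `H^∞` preserves `H²₊`, the inclusions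
and, for invertible `h`, the equalities follow by multiplying this equation by `h` or `h⁻¹`.

For strictness, let `h = θ g` with `θ` inner and non-constant. If one of the inclusions were an
equality, every element of the larger kernel `N` would be divisible by `θ` in `H²₊`. Multiplication
by `conj θ` preserves `H²₋`, so the quotients lie in `N` again (`kerPlus_eq_bot_of_le_mulSpace`),
and `N` is invariant under division by `θ`. Such a subspace is trivial
(`eq_bot_of_forall_mulOp_star_mem`): if the Fourier coefficients of index less than `m` vanish on
`N`, then, `c` being the mean of `θ`, dividing `k` times by `θ` bounds the `m`-th coefficient of
`f ∈ N` by `|c| ^ k * ‖f‖`, and `|c| < 1` because `θ` is not constant.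
-/

namespace PairedKernel

/-! ### Multiplication operators -/

theorem mulOp_mulInf (a b : LInf) (f : L2) : mulOp (mulInf a b) f = mulOp a (mulOp b f) := by
  refine Lp.ext ?_
  filter_upwards [coeFn_mulOp (mulInf a b) f, coeFn_mulInf a b, coeFn_mulOp a (mulOp b f),
    coeFn_mulOp b f] with t h1 h2 h3 h4
  rw [h1, h2, h3, h4, mul_assoc]

theorem mulOp_comm (a b : LInf) (f : L2) : mulOp a (mulOp b f) = mulOp b (mulOp a f) := by
  refine Lp.ext ?_
  filter_upwards [coeFn_mulOp a (mulOp b f), coeFn_mulOp b f, coeFn_mulOp b (mulOp a f),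
    coeFn_mulOp a f] with t h1 h2 h3 h4
  rw [h1, h2, h3, h4, mul_left_comm]

theorem mulOp_mulOp_eq_self {h k : LInf} (hk : ∀ᵐ t ∂circleMeasure, h t * k t = 1) (f : L2) :
    mulOp h (mulOp k f) = f := by
  refine Lp.ext ?_
  filter_upwards [coeFn_mulOp h (mulOp k f), coeFn_mulOp k f, hk] with t h1 h2 h3
  rw [h1, h2, ← mul_assoc, h3, one_mul]

theorem inner_mulOp_star (a : LInf) (f g : L2) :
    inner ℂ (mulOp (star a) f) g = inner ℂ f (mulOp a g) := by
  rw [L2.inner_def, L2.inner_def]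
  refine integral_congr_ae ?_
  filter_upwards [coeFn_mulOp (star a) f, coeFn_mulOp a g, Lp.coeFn_star a] with t h1 h2 h3
  rw [h1, h2, h3]
  simp only [Pi.star_apply, RCLike.inner_apply, RCLike.star_def, map_mul,
    RingHomCompTriple.comp_apply, RingHom.id_apply]
  ring

/-! ### Fourier coefficients of products -/

theorem inner_fourierBasis (f : L2) (n : ℤ) :
    inner ℂ (fourierBasis (T := 1) n) f = fourierCoeff f n := by
  rw [← fourierBasis_repr, HilbertBasis.repr_apply_apply]

theorem coeFn_fourierBasis (n : ℤ) :
    (fourierBasis (T := 1) n : L2) =ᵐ[circleMeasure] fourier n := by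
  rw [coe_fourierBasis]
  exact coeFn_fourierLp 2 n

/-- Multiplication by `z ^ i` shifts Fourier coefficients by `i`. -/
theorem fourierCoeff_mulOp_fourierBasis (a : LInf) (i m : ℤ) :
    fourierCoeff (mulOp a (fourierBasis (T := 1) i)) m = fourierCoeff a (m - i) := by
  unfold fourierCoeff
  refine integral_congr_ae ?_
  filter_upwards [coeFn_mulOp a (fourierBasis (T := 1) i), coeFn_fourierBasis i] with t h1 h2
  rw [h1, h2, smul_eq_mul, smul_eq_mul, show -(m - i) = -m + i by ring, fourier_add]
  ring

/-- The Fourier coefficients of a product are the convolution of the Fourier coefficients. -/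
theorem hasSum_fourierCoeff_mulOp (a : LInf) (f : L2) (m : ℤ) :
    HasSum (fun i : ℤ => fourierCoeff f i * fourierCoeff a (m - i))
      (fourierCoeff (mulOp a f) m) := by
  have h := ((fourierBasis (T := 1)).hasSum_repr f).mapL
    ((innerSL ℂ (fourierBasis (T := 1) m : L2)) ∘L mulOp a)
  simpa only [ContinuousLinearMap.comp_apply, innerSL_apply_apply, map_smul, smul_eq_mul,
    inner_fourierBasis, fourierCoeff_mulOp_fourierBasis, fourierBasis_repr] using h

theorem mulOp_mem_hardyPlus {a : LInf} (ha : a ∈ HInf) {f : L2} (hf : f ∈ HardyPlus) :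
    mulOp a f ∈ HardyPlus := by
  intro n hn
  refine (hasSum_fourierCoeff_mulOp a f n).unique ?_
  convert hasSum_zero (α := ℂ) (β := ℤ) using 2 with i
  rcases lt_or_ge i 0 with hi | hi
  · rw [hf i hi, zero_mul]
  · rw [ha (n - i) (by omega), mul_zero]

theorem fourierCoeff_mulOp_of_forall_lt {a : LInf} (ha : a ∈ HInf) {f : L2} {m : ℤ}
    (hf : ∀ i < m, fourierCoeff f i = 0) :
    fourierCoeff (mulOp a f) m = fourierCoeff a 0 * fourierCoeff f m := by
  refine (hasSum_fourierCoeff_mulOp a f m).unique ?_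
  convert hasSum_single (f := fun i : ℤ => fourierCoeff f i * fourierCoeff a (m - i)) m ?_ using 1
  · rw [sub_self, mul_comm]
  · intro i hi
    rcases lt_or_gt_of_ne hi with hi | hi
    · rw [hf i hi, zero_mul]
    · rw [ha (m - i) (by omega), mul_zero]

theorem norm_fourierCoeff_le (f : L2) (n : ℤ) : ‖fourierCoeff f n‖ ≤ ‖f‖ := by
  rw [← inner_fourierBasis]
  have h := norm_inner_le_norm (𝕜 := ℂ) (fourierBasis (T := 1) n : L2) f
  rwa [(fourierBasis (T := 1)).orthonormal.1 n, one_mul] at h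

theorem eq_zero_of_fourierCoeff {f : L2} (hf : ∀ n, fourierCoeff f n = 0) : f = 0 := by
  refine (fourierBasis (T := 1)).repr.injective (lp.ext (funext fun n => ?_))
  rw [fourierBasis_repr, hf n, map_zero]
  rfl

/-! ### Inner functions -/

theorem IsInner.mul_star {θ : LInf} (hθ : IsInner θ) :
    ∀ᵐ t ∂circleMeasure, θ t * (star θ : LInf) t = 1 := by
  filter_upwards [hθ.2, Lp.coeFn_star θ] with t h1 h2
  rw [h2, Pi.star_apply, RCLike.star_def, RCLike.mul_conj, h1]
  simp

theorem IsInner.norm_mulOp_star {θ : LInf} (hθ : IsInner θ) (f : L2) :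
    ‖mulOp (star θ) f‖ = ‖f‖ := by
  rw [← sq_eq_sq₀ (norm_nonneg _) (norm_nonneg _), ← inner_self_eq_norm_sq (𝕜 := ℂ),
    ← inner_self_eq_norm_sq (𝕜 := ℂ), inner_mulOp_star, mulOp_mulOp_eq_self hθ.mul_star]

theorem IsInner.mulOp_star_mem_hardyMinus {θ : LInf} (hθ : IsInner θ) {f : L2}
    (hf : f ∈ HardyMinus) : mulOp (star θ) f ∈ HardyMinus := by
  refine (Submodule.mem_orthogonal' _ _).2 fun u hu => ?_
  rw [inner_mulOp_star]
  exact (Submodule.mem_orthogonal' _ _).1 hf _ (mulOp_mem_hardyPlus hθ.1 hu)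

/-- The mean of a non-constant inner function, that is, its value at the origin of the disc, has
modulus less than one: with `c` the mean, `‖θ - c‖² = 1 - |c|²`. -/
theorem IsInner.norm_fourierCoeff_zero_lt_one {θ : LInf} (hθ : IsInner θ)
    (hc : ¬ IsConstant θ) : ‖fourierCoeff θ 0‖ < 1 := by
  set c := fourierCoeff θ 0
  set e : L2 := fourierBasis (T := 1) 0 with he
  have he1 : ‖e‖ = 1 := (fourierBasis (T := 1)).orthonormal.1 0
  have hin : inner ℂ e (mulOp θ e) = c := by
    rw [inner_fourierBasis, fourierCoeff_mulOp_fourierBasis, sub_zero]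
  have hnorm : ‖mulOp θ e‖ = 1 := by
    rw [← hθ.norm_mulOp_star, mulOp_comm, mulOp_mulOp_eq_self hθ.mul_star, he1]
  have hle : ‖c‖ ≤ 1 := by
    rw [← hin]
    simpa [he1, hnorm] using norm_inner_le_norm (𝕜 := ℂ) e (mulOp θ e)
  refine lt_of_le_of_ne hle fun h1 => hc ⟨c, ?_⟩
  -- Equality in the Cauchy–Schwarz inequality makes `θ` proportional to `1`.
  have heq : mulOp θ e = c • e := by
    have hz : ‖mulOp θ e - c • e‖ ^ 2 = 0 := by
      rw [norm_sub_sq (𝕜 := ℂ), inner_smul_right, ← inner_conj_symm, hin, RCLike.mul_conj,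
        norm_smul, hnorm, he1, h1]
      norm_num
    exact sub_eq_zero.1 (norm_eq_zero.1 (pow_eq_zero_iff two_ne_zero |>.1 hz))
  filter_upwards [coeFn_mulOp θ e, coeFn_fourierBasis 0, Lp.coeFn_smul c e] with t h2 h3 h4
  rw [heq, h4, Pi.smul_apply, he, h3] at h2
  simpa using h2.symm

/-- A subspace of `H²₊` that stays invariant under division by a non-constant inner function is
trivial. -/
theorem eq_bot_of_forall_mulOp_star_mem {θ : LInf} (hθ : IsInner θ) (hc : ¬ IsConstant θ)
    {N : Submodule ℂ L2} (hN : N ≤ HardyPlus) (hdiv : ∀ f ∈ N, mulOp (star θ) f ∈ N) :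
    N = ⊥ := by
  have key : ∀ m : ℕ, ∀ f ∈ N, fourierCoeff f m = 0 := by
    intro m
    induction m using Nat.strong_induction_on with
    | _ m ih =>
      have hlow : ∀ f ∈ N, ∀ i < (m : ℤ), fourierCoeff f i = 0 := by
        intro f hf i hi
        rcases lt_or_ge i 0 with h0 | h0
        · exact hN hf i h0
        · lift i to ℕ using h0
          exact ih i (by exact_mod_cast hi) f hf
      have hbound : ∀ k : ℕ, ∀ f ∈ N, ‖fourierCoeff f m‖ ≤ ‖fourierCoeff θ 0‖ ^ k * ‖f‖ := by
        intro k
        induction k with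
        | zero => intro f _; simpa using norm_fourierCoeff_le f m
        | succ k ihk =>
          intro f hf
          have h := fourierCoeff_mulOp_of_forall_lt hθ.1 (hlow _ (hdiv f hf))
          rw [mulOp_mulOp_eq_self hθ.mul_star] at h
          rw [h, norm_mul, pow_succ', mul_assoc, ← hθ.norm_mulOp_star f]
          exact mul_le_mul_of_nonneg_left (ihk _ (hdiv f hf)) (norm_nonneg _)
      intro f hf
      have ht := (tendsto_pow_atTop_nhds_zero_of_lt_one (norm_nonneg _)
        (hθ.norm_fourierCoeff_zero_lt_one hc)).mul_const ‖f‖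
      rw [zero_mul] at ht
      exact norm_le_zero_iff.1 (ge_of_tendsto' ht fun k => hbound k f hf)
  refine (Submodule.eq_bot_iff N).2 fun f hf => eq_zero_of_fourierCoeff fun n => ?_
  rcases lt_or_ge n 0 with hn | hn
  · exact hN hf n hn
  · lift n to ℕ using hn
    exact key n f hf

/-! ### Projected paired kernels -/

theorem mem_kerPlus_iff {a b : LInf} {f : L2} :
    f ∈ kerPlus a b ↔ f ∈ HardyPlus ∧ ∃ g ∈ HardyMinus, mulOp a f + mulOp b g = 0 := by
  constructor
  · rintro ⟨u, hu, rfl⟩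
    exact ⟨HardyPlus.starProjection_apply_mem u, projMinus u,
      HardyMinus.starProjection_apply_mem u, hu⟩
  · rintro ⟨hf, g, hg, hfg⟩
    have hp : projPlus (f + g) = f := by
      rw [map_add, projPlus, Submodule.starProjection_eq_self_iff.2 hf,
        Submodule.starProjection_apply_eq_zero_iff HardyPlus |>.2 hg, add_zero]
    have hm : projMinus (f + g) = g := by
      rw [map_add, projMinus, Submodule.starProjection_eq_self_iff.2 hg,
        Submodule.starProjection_apply_eq_zero_iff HardyMinus |>.2
          (HardyPlus.le_orthogonal_orthogonal hf), zero_add]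
    refine ⟨f + g, ?_, hp⟩
    change mulOp a (projPlus (f + g)) + mulOp b (projMinus (f + g)) = 0
    rw [hp, hm, hfg]

theorem kerPlus_le_hardyPlus (a b : LInf) : kerPlus a b ≤ HardyPlus :=
  fun _ hf => (mem_kerPlus_iff.1 hf).1

theorem mulSpace_kerPlus_mulInf_left_le (a b : LInf) {h : LInf} (hh : h ∈ HInf) :
    mulSpace h (kerPlus (mulInf a h) b) ≤ kerPlus a b := by
  rintro _ ⟨f, hf, rfl⟩
  obtain ⟨hf, g, hg, hfg⟩ := mem_kerPlus_iff.1 hf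
  rw [mulOp_mulInf] at hfg
  exact mem_kerPlus_iff.2 ⟨mulOp_mem_hardyPlus hh hf, g, hg, hfg⟩

theorem mulSpace_kerPlus_le_kerPlus_mulInf_right (a b : LInf) {h : LInf} (hh : h ∈ HInf) :
    mulSpace h (kerPlus a b) ≤ kerPlus a (mulInf b h) := by
  rintro _ ⟨f, hf, rfl⟩
  obtain ⟨hf, g, hg, hfg⟩ := mem_kerPlus_iff.1 hf
  refine mem_kerPlus_iff.2 ⟨mulOp_mem_hardyPlus hh hf, g, hg, ?_⟩
  change mulOp a (mulOp h f) + _ = 0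
  rw [mulOp_mulInf, mulOp_comm a h, mulOp_comm b h, ← map_add, hfg, map_zero]

theorem mulSpace_kerPlus_mulInf_left_eq (a b : LInf) {h k : LInf} (hk : IsInverseInHInf h k) :
    mulSpace h (kerPlus (mulInf a h) b) = kerPlus a b := by
  refine le_antisymm (mulSpace_kerPlus_mulInf_left_le a b hk.1) fun f hf => ?_
  obtain ⟨hf, g, hg, hfg⟩ := mem_kerPlus_iff.1 hf
  have hself := mulOp_mulOp_eq_self hk.2.2 f
  refine ⟨mulOp k f, mem_kerPlus_iff.2 ⟨mulOp_mem_hardyPlus hk.2.1 hf, g, hg, ?_⟩, hself⟩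
  rw [mulOp_mulInf, hself, hfg]

theorem kerPlus_eq_mulSpace_kerPlus_mulInf_right (a b : LInf) {h k : LInf}
    (hk : IsInverseInHInf h k) : kerPlus a b = mulSpace k (kerPlus a (mulInf b h)) := by
  have hself (f : L2) : mulOp k (mulOp h f) = f := by
    rw [mulOp_comm, mulOp_mulOp_eq_self hk.2.2]
  refine le_antisymm (fun f hf => ⟨mulOp h f, mulSpace_kerPlus_le_kerPlus_mulInf_right a b hk.1
    ⟨f, hf, rfl⟩, hself f⟩) ?_
  rintro _ ⟨f, hf, rfl⟩
  obtain ⟨hf, g, hg, hfg⟩ := mem_kerPlus_iff.1 hf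
  refine mem_kerPlus_iff.2 ⟨mulOp_mem_hardyPlus hk.2.1 hf, g, hg, ?_⟩
  change mulOp a (mulOp k f) + _ = 0
  rw [← hself (mulOp b g), mulOp_comm a k, mulOp_comm h b, ← mulOp_mulInf b h, ← map_add, hfg,
    map_zero]

/-- If all elements of `ker⁺_{a,b}` are divisible by `θ` in `H²₊`, then the quotients lie in
`ker⁺_{a,b}` again, because multiplication by `conj θ` preserves `H²₋`. Hence `ker⁺_{a,b}` is
trivial when `θ` is a non-constant inner function. -/
theorem kerPlus_eq_bot_of_le_mulSpace {a b θ : LInf} (hθ : IsInner θ) (hc : ¬ IsConstant θ)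
    (hle : kerPlus a b ≤ mulSpace θ HardyPlus) : kerPlus a b = ⊥ := by
  refine eq_bot_of_forall_mulOp_star_mem hθ hc (kerPlus_le_hardyPlus a b) fun f hf => ?_
  obtain ⟨u, hu, rfl⟩ := hle hf
  obtain ⟨-, g, hg, hfg⟩ := mem_kerPlus_iff.1 hf
  change mulOp a (mulOp θ u) + _ = 0 at hfg
  change mulOp (star θ) (mulOp θ u) ∈ _
  have hself (v : L2) : mulOp (star θ) (mulOp θ v) = v := by
    rw [mulOp_comm, mulOp_mulOp_eq_self hθ.mul_star]
  rw [hself]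
  refine mem_kerPlus_iff.2 ⟨hu, mulOp (star θ) g, hθ.mulOp_star_mem_hardyMinus hg, ?_⟩
  rw [← hself (mulOp a u), mulOp_comm θ a, mulOp_comm b, ← map_add, hfg, map_zero]

theorem mulSpace_mulInf_le {θ g : LInf} (hg : g ∈ HInf) {M : Submodule ℂ L2}
    (hM : M ≤ HardyPlus) : mulSpace (mulInf θ g) M ≤ mulSpace θ HardyPlus := by
  rintro _ ⟨f, hf, rfl⟩
  exact ⟨mulOp g f, mulOp_mem_hardyPlus hg (hM hf), (mulOp_mulInf θ g f).symm⟩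

theorem mulSpace_ne_kerPlus {a b h : LInf} (hh : HasNonconstantInnerFactor h)
    {M : Submodule ℂ L2} (hM : M ≤ HardyPlus) (hker : kerPlus a b ≠ ⊥) :
    mulSpace h M ≠ kerPlus a b := by
  obtain ⟨θ, g, hθ, hc, hg, rfl⟩ := hh
  exact fun heq => hker (kerPlus_eq_bot_of_le_mulSpace hθ hc (heq ▸ mulSpace_mulInf_le hg hM))

end PairedKernel

theorem proposition6p5 (a b : PairedKernel.LInf) (hab : PairedKernel.Nondegenerate a b)
    (h : PairedKernel.LInf) (hh : h ∈ PairedKernel.HInf) :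
    (PairedKernel.mulSpace h (PairedKernel.kerPlus (PairedKernel.mulInf a h) b)
        ≤ PairedKernel.kerPlus a b ∧
      PairedKernel.mulSpace h (PairedKernel.kerPlus a b)
        ≤ PairedKernel.kerPlus a (PairedKernel.mulInf b h)) ∧
    (∀ k : PairedKernel.LInf, PairedKernel.IsInverseInHInf h k →
      PairedKernel.mulSpace h (PairedKernel.kerPlus (PairedKernel.mulInf a h) b)
        = PairedKernel.kerPlus a b ∧
      PairedKernel.kerPlus a b
        = PairedKernel.mulSpace k (PairedKernel.kerPlus a (PairedKernel.mulInf b h))) ∧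
    (PairedKernel.HasNonconstantInnerFactor h →
      (PairedKernel.kerPlus a b ≠ ⊥ →
        PairedKernel.mulSpace h (PairedKernel.kerPlus (PairedKernel.mulInf a h) b)
          < PairedKernel.kerPlus a b) ∧
      (PairedKernel.kerPlus a (PairedKernel.mulInf b h) ≠ ⊥ →
        PairedKernel.mulSpace h (PairedKernel.kerPlus a b)
          < PairedKernel.kerPlus a (PairedKernel.mulInf b h))) := by
  have hleft := PairedKernel.mulSpace_kerPlus_mulInf_left_le a b hh
  have hright := PairedKernel.mulSpace_kerPlus_le_kerPlus_mulInf_right a b hh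
  refine ⟨⟨hleft, hright⟩, fun k hk => ?_, fun hfac => ⟨fun hker => ?_, fun hker => ?_⟩⟩
  · exact ⟨PairedKernel.mulSpace_kerPlus_mulInf_left_eq a b hk,
      PairedKernel.kerPlus_eq_mulSpace_kerPlus_mulInf_right a b hk⟩
  · exact lt_of_le_of_ne hleft
      (PairedKernel.mulSpace_ne_kerPlus hfac (PairedKernel.kerPlus_le_hardyPlus _ _) hker)
  · exact lt_of_le_of_ne hright
      (PairedKernel.mulSpace_ne_kerPlus hfac (PairedKernel.kerPlus_le_hardyPlus _ _) hker)
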